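/- Let $n\ge 1$ and let a finite group $G$ act on the algebra $A=M_n(\mathbb{C})$ by $*$-automorphisms, i.e. through a homomorphism $G\to \mathrm{Aut}(A)=PU(n)$. Let $\widetilde G=G\times_{PU(n)}SU(n)$ be the pull-back of $SU(n)\to PU(n)$ along this homomorphism; it is a central extension of $G$ by the group $\mu_n$ of $n$-th roots of unity, with projection $\pi:\widetilde G\to G$. Let $G\ltimes A$ be the semi-direct (crossed) product algebra, consisting of the sums $\sum_{g\in G}a_g\,g$ with $a_g\in A$ and $(a\,g)(b\,h)=a\,(g\cdot b)\,gh$. For a ring $R$ let $K(R)$ be the Grothendieck group of finitely generated projective left $R$-modules, and let $K_G(A)$ be the Grothendieck group of the category of finitely generated projective left $A$-modules $E$ with a left action of $G$ by additive maps such that $g(ae)=(g\cdot a)(ge)$ (this is the twisted equivariant $K$-group $K_G^{(A)}(X)$ for $X$ a point). Then: 1. $K_G(A)\cong K(G\ltimes A)$, by the isomorphism sending the class of $E$ to the class of $E$ regarded as a $G\ltimes A$-module. 2. $K(G\ltimes A)$ is a free abelian group of finite rank, and its rank is the number of conjugacy classes $C$ of $G$ that split into $n$ conjugacy classes in $\widetilde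 G$, i.e. such that $\pi^{-1}(C)$ is the union of exactly $n$ conjugacy classes of $\widetilde G$. 3. The $\mathbb{C}$-vector space of functions of linear type on $\widetilde G$, i.e. of functions $f:\widetilde G\to\mathbb{C}$ with $f(hxh^{-1})=f(x)$ for all $h,x\in\widetilde G$ and $f(\lambda x)=\lambda f(x)$ for all $\lambda\in\mu_n$, $x\in\widetilde G$, is isomorphic to the space of complex functions on the set of conjugacy classes of $G$ that split into $n$ conjugacy classes in $\widetilde G$; in particular its dimension equals the rank in 2. -/

import Mathlib

universe u v

/-! ### The Grothendieck group `K(R)` of finitely generated projective left modules -/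

/-- An object of `𝒫(R)`: a finitely generated projective left `R`-module. -/
structure ProjMod (R : Type u) [Ring R] where
  carrier : Type u
  [addCommGroup : AddCommGroup carrier]
  [module : Module R carrier]
  [finite : Module.Finite R carrier]
  [projective : Module.Projective R carrier]

attribute [instance] ProjMod.addCommGroup ProjMod.module ProjMod.finite ProjMod.projective

namespace ProjMod

variable (R : Type u) [Ring R]

/-- Two objects are identified when they are isomorphic as `R`-modules. -/
instance isoSetoid : Setoid (ProjMod R) where
  r M N := Nonempty (M.carrier ≃ₗ[R] N.carrier)
  iseqv :=
    { refl := fun _ => ⟨LinearEquiv.refl R _⟩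
      symm := fun ⟨e⟩ => ⟨e.symm⟩
      trans := fun ⟨e⟩ ⟨f⟩ => ⟨e.trans f⟩ }

/-- Isomorphism classes of finitely generated projective `R`-modules. -/
def IsoClass : Type (u + 1) := Quotient (isoSetoid R)

variable {R}

/-- The isomorphism class of a module. -/
def toIsoClass (M : ProjMod R) : IsoClass R := Quotient.mk _ M

/-- The direct sum. -/
def dsum (M N : ProjMod R) : ProjMod R where
  carrier := M.carrier × N.carrier

/-- The zero module. -/
def zeroMod : ProjMod R where
  carrier := PUnit.{u + 1}

instance : Zero (IsoClass R) := ⟨toIsoClass zeroMod⟩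

instance : Add (IsoClass R) :=
  ⟨Quotient.map₂ dsum fun _ _ ⟨e⟩ _ _ ⟨f⟩ => ⟨LinearEquiv.prodCongr e f⟩⟩

/-- Isomorphism classes form a commutative monoid under direct sum. -/
instance : AddCommMonoid (IsoClass R) where
  add_assoc := by
    rintro ⟨M⟩ ⟨N⟩ ⟨P⟩
    exact Quotient.sound ⟨LinearEquiv.prodAssoc R _ _ _⟩
  zero_add := by
    rintro ⟨M⟩
    exact Quotient.sound
      ⟨(LinearEquiv.uniqueProd : (PUnit.{u + 1} × M.carrier) ≃ₗ[R] M.carrier)⟩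
  add_zero := by
    rintro ⟨M⟩
    exact Quotient.sound
      ⟨(LinearEquiv.prodUnique : (M.carrier × PUnit.{u + 1}) ≃ₗ[R] M.carrier)⟩
  add_comm := by
    rintro ⟨M⟩ ⟨N⟩
    exact Quotient.sound ⟨LinearEquiv.prodComm R _ _⟩
  nsmul := nsmulRec

end ProjMod

/-- `K(R) = K₀(R)`: the Grothendieck group of the category of finitely generated projective
left `R`-modules. -/
abbrev KGroup (R : Type u) [Ring R] : Type (u + 1) :=
  Algebra.GrothendieckAddGroup (ProjMod.IsoClass R)

/-- The class `[M] ∈ K(R)`. -/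
def ProjMod.toK {R : Type u} [Ring R] (M : ProjMod R) : KGroup R :=
  Algebra.GrothendieckAddGroup.of M.toIsoClass

/-! ### The equivariant Grothendieck group `K_G(A)` (for a discrete group `G`) -/

/-- An object of `𝒫_G(A)`: a finitely generated projective left `A`-module `E` with a left action
of `G` by additive maps such that `g • (a • e) = (g • a) • (g • e)`. -/
structure EquivProjMod (G : Type u) (A : Type v) [Group G] [Ring A] [MulSemiringAction G A] where
  carrier : Type (max u v)
  [addCommGroup : AddCommGroup carrier]
  [module : Module A carrier]
  [action : DistribMulAction G carrier]
  [finite : Module.Finite A carrier]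
  [projective : Module.Projective A carrier]
  smul_smul' : ∀ (g : G) (a : A) (e : carrier), g • (a • e) = (g • a) • (g • e)

attribute [instance] EquivProjMod.addCommGroup EquivProjMod.module EquivProjMod.action
  EquivProjMod.finite EquivProjMod.projective

namespace EquivProjMod

variable (G : Type u) (A : Type v) [Group G] [Ring A] [MulSemiringAction G A]

/-- Two objects are identified when there is a `G`-equivariant `A`-linear isomorphism. -/
instance isoSetoid : Setoid (EquivProjMod G A) where
  r E F := ∃ φ : E.carrier ≃ₗ[A] F.carrier, ∀ (g : G) (e : E.carrier), φ (g • e) = g • φ e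
  iseqv :=
    { refl := fun _ => ⟨LinearEquiv.refl A _, fun _ _ => rfl⟩
      symm := by
        rintro E F ⟨φ, h⟩
        exact ⟨φ.symm, fun g e => φ.injective (by simp [h])⟩
      trans := by
        rintro E F H ⟨φ, h⟩ ⟨ψ, k⟩
        exact ⟨φ.trans ψ, fun g e => by simp [h, k]⟩ }

/-- Isomorphism classes of objects of `𝒫_G(A)`. -/
def IsoClass : Type (max u v + 1) := Quotient (isoSetoid G A)

variable {G A}

/-- The isomorphism class of an object. -/
def toIsoClass (E : EquivProjMod G A) : IsoClass G A := Quotient.mk _ E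

/-- The direct sum, with `G` acting componentwise. -/
def dsum (E F : EquivProjMod G A) : EquivProjMod G A where
  carrier := E.carrier × F.carrier
  smul_smul' g a e := Prod.ext (E.smul_smul' g a e.1) (F.smul_smul' g a e.2)

/-- The zero object. -/
def zeroMod : EquivProjMod G A where
  carrier := PUnit.{max u v + 1}
  action :=
    { smul := fun _ x => x
      one_smul := fun _ => rfl
      mul_smul := fun _ _ _ => rfl
      smul_zero := fun _ => rfl
      smul_add := fun _ _ _ => rfl }
  smul_smul' _ _ _ := rfl

instance : Zero (IsoClass G A) := ⟨toIsoClass zeroMod⟩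

instance : Add (IsoClass G A) :=
  ⟨Quotient.map₂ dsum fun _ _ ⟨φ, h⟩ _ _ ⟨ψ, k⟩ =>
    ⟨LinearEquiv.prodCongr φ ψ, fun g e => Prod.ext (h g e.1) (k g e.2)⟩⟩

/-- Isomorphism classes form a commutative monoid under direct sum. -/
instance : AddCommMonoid (IsoClass G A) where
  add_assoc := by
    rintro ⟨E⟩ ⟨F⟩ ⟨H⟩
    exact Quotient.sound ⟨LinearEquiv.prodAssoc A _ _ _, fun _ _ => rfl⟩
  zero_add := by
    rintro ⟨E⟩
    exact Quotient.sound
      ⟨(LinearEquiv.uniqueProd : (PUnit.{max u v + 1} × E.carrier) ≃ₗ[A] E.carrier),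
        fun _ _ => rfl⟩
  add_zero := by
    rintro ⟨E⟩
    exact Quotient.sound
      ⟨(LinearEquiv.prodUnique : (E.carrier × PUnit.{max u v + 1}) ≃ₗ[A] E.carrier),
        fun _ _ => rfl⟩
  add_comm := by
    rintro ⟨E⟩ ⟨F⟩
    exact Quotient.sound ⟨LinearEquiv.prodComm A _ _, fun _ _ => rfl⟩
  nsmul := nsmulRec

end EquivProjMod

/-- `K_G(A)`: the Grothendieck group of the category `𝒫_G(A)`. -/
abbrev EquivKGroup (G : Type u) (A : Type v) [Group G] [Ring A] [MulSemiringAction G A] :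
    Type (max u v + 1) :=
  Algebra.GrothendieckAddGroup (EquivProjMod.IsoClass G A)

/-- The class `[E] ∈ K_G(A)`. -/
def EquivProjMod.toK {G : Type u} {A : Type v} [Group G] [Ring A] [MulSemiringAction G A]
    (E : EquivProjMod G A) : EquivKGroup G A :=
  Algebra.GrothendieckAddGroup.of E.toIsoClass

/-- The semi-direct (crossed) product `G ⋉ A`: finite sums `∑ a_g g` with
`(a g) (b h) = (a (g • b)) (g h)`. -/
abbrev CrossedProduct (G : Type u) (A : Type v) [Group G] [Ring A] [MulSemiringAction G A] :
    Type (max u v) :=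
  SkewMonoidAlgebra A G

/-- The `G ⋉ A`-module `M` and the `G`-equivariant `A`-module `E` have the same underlying additive
group, `A` and `G` acting on `E` through their images in `G ⋉ A`. -/
def SameModule {G : Type u} {A : Type v} [Group G] [Ring A] [MulSemiringAction G A]
    (E : EquivProjMod G A) (M : ProjMod (CrossedProduct G A)) : Prop :=
  ∃ φ : E.carrier ≃+ M.carrier,
    (∀ (a : A) (e : E.carrier),
      φ (a • e) = (SkewMonoidAlgebra.single (1 : G) a : CrossedProduct G A) • φ e) ∧
    (∀ (g : G) (e : E.carrier),
      φ (g • e) = (SkewMonoidAlgebra.single g (1 : A) : CrossedProduct G A) • φ e)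

/-! ### The central extension and functions of linear type -/

/-- The algebra `M_n(ℂ)`. -/
abbrev MatC (n : ℕ) : Type := Matrix (Fin n) (Fin n) ℂ

/-- For `G` acting on `M_n(ℂ)` by `*`-automorphisms, i.e. through
`G → Aut(M_n(ℂ)) = PU(n)`, this is the pull-back of `SU(n) → PU(n)` along `G → PU(n)`:
the group of pairs `(g, s)` with `s ∈ SU(n)` such that `g` acts as conjugation by `s`. -/
def TildeGroup (G : Type u) (n : ℕ) [Group G] [MulSemiringAction G (MatC n)] :
    Subgroup (G × Matrix.specialUnitaryGroup (Fin n) ℂ) where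
  carrier := {p | ∀ a : MatC n, p.1 • a = (p.2 : MatC n) * a * ((p.2⁻¹ :
    Matrix.specialUnitaryGroup (Fin n) ℂ) : MatC n)}
  one_mem' a := by simp
  mul_mem' {p q} hp hq a := by
    simp only [Prod.fst_mul, Prod.snd_mul, mul_smul, mul_inv_rev, Submonoid.coe_mul]
    rw [hq a, hp]
    simp only [mul_assoc]
  inv_mem' {p} hp a := by
    have h1 : ((p.2⁻¹ : Matrix.specialUnitaryGroup (Fin n) ℂ) : MatC n) * (p.2 : MatC n) = 1 := by
      rw [← Submonoid.coe_mul, inv_mul_cancel, Submonoid.coe_one]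
    have h2 : (p.2 : MatC n) * ((p.2⁻¹ : Matrix.specialUnitaryGroup (Fin n) ℂ) : MatC n) = 1 := by
      rw [← Submonoid.coe_mul, mul_inv_cancel, Submonoid.coe_one]
    simp only [Prod.fst_inv, Prod.snd_inv, inv_inv]
    rw [inv_smul_eq_iff, hp]
    simp only [mul_assoc, h2, mul_one]
    rw [← mul_assoc, h2, one_mul]

namespace TildeGroup

variable (G : Type u) (n : ℕ) [Group G] [MulSemiringAction G (MatC n)]

/-- The projection `π : G̃ → G`. -/
def proj : TildeGroup G n →* G :=
  (MonoidHom.fst G (Matrix.specialUnitaryGroup (Fin n) ℂ)).comp (TildeGroup G n).subtype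

/-- A scalar matrix `λ` with `λ ^ n = 1`, as an element of `SU(n)`. -/
def scalarSU [NeZero n] (z : rootsOfUnity n ℂ) : Matrix.specialUnitaryGroup (Fin n) ℂ :=
  ⟨Matrix.scalar (Fin n) ((z : ℂˣ) : ℂ), by
    have hz : ((z : ℂˣ) : ℂ) ^ n = 1 := (mem_rootsOfUnity' n _).1 z.2
    have hnorm : ‖((z : ℂˣ) : ℂ)‖ = 1 := Complex.norm_eq_one_of_pow_eq_one hz (NeZero.ne n)
    rw [Matrix.mem_specialUnitaryGroup_iff, Matrix.mem_unitaryGroup_iff]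
    refine ⟨?_, by simp [hz]⟩
    have h : ((z : ℂˣ) : ℂ) * star ((z : ℂˣ) : ℂ) = 1 := by
      have := Complex.mul_conj ((z : ℂˣ) : ℂ)
      simpa [Complex.normSq_eq_norm_sq, hnorm] using this
    rw [Matrix.star_eq_conjTranspose, Matrix.scalar_apply, Matrix.diagonal_conjTranspose,
      Matrix.diagonal_mul_diagonal, ← Matrix.diagonal_one]
    congr 1
    funext i
    exact h⟩

/-- The inclusion of the fibre, `μ_n → G̃`, `λ ↦ (1, λ)`. -/
def ofMu [NeZero n] (z : rootsOfUnity n ℂ) : TildeGroup G n :=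
  ⟨(1, scalarSU n z), fun a => by
    have hc : ((scalarSU n z : Matrix.specialUnitaryGroup (Fin n) ℂ) : MatC n) * a
        = a * ((scalarSU n z : Matrix.specialUnitaryGroup (Fin n) ℂ) : MatC n) :=
      (Matrix.scalar_commute _ (fun _ => Commute.all _ _) a).eq
    rw [one_smul, hc, mul_assoc, ← Submonoid.coe_mul, mul_inv_cancel, Submonoid.coe_one,
      mul_one]⟩

/-- The conjugacy classes of `G` which split into `n` conjugacy classes in `G̃`: those whose
preimage in `G̃` is the union of exactly `n` conjugacy classes. -/
def SplitClass : Type u :=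
  {C : ConjClasses G //
    Nat.card {D : ConjClasses (TildeGroup G n) // ConjClasses.map (proj G n) D = C} = n}

/-- The `ℂ`-vector space of functions of linear type on `G̃`: class functions `f` with
`f (λ x) = λ f x` for every `λ ∈ μ_n`. -/
def LinearTypeFun [NeZero n] : Submodule ℂ (TildeGroup G n → ℂ) where
  carrier := {f | (∀ h x, f (h * x * h⁻¹) = f x) ∧
    ∀ (z : rootsOfUnity n ℂ) (x), f (ofMu G n z * x) = ((z : ℂˣ) : ℂ) * f x}
  zero_mem' := ⟨fun _ _ => rfl, fun _ _ => by simp⟩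
  add_mem' := by
    rintro f f' ⟨h1, h2⟩ ⟨h1', h2'⟩
    exact ⟨fun h x => by simp [h1, h1'], fun z x => by simp [h2, h2', mul_add]⟩
  smul_mem' := by
    rintro c f ⟨h1, h2⟩
    exact ⟨fun h x => by simp [h1], fun z x => by simp [h2, mul_left_comm]⟩

end TildeGroup

/-!
Since `|G|` is invertible in `A = M_n(ℂ)`, averaging over `G` turns `A`-linear sections into
`G ⋉ A`-linear ones. Hence equivariant projective `A`-modules are the same as projective
`G ⋉ A`-modules, and `G ⋉ A` is semisimple. The group `K` of a finite-dimensional semisimple algebra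
over an algebraically closed field is free on the simple modules, and its rank is the dimension of
the center.

Every automorphism in the image of `G` is conjugation by some `s ∈ SU(n)`, so `π : G̃ → G` is
onto. If `∑ a_g g` is central and `x = (g, s) ∈ G̃`, then `a_g s` is a scalar matrix `f(x)`, and
`∑ a_g g ↦ f` identifies the center with the functions of linear type. These are the
`μ_n`-equivariant functions on the set of conjugacy classes of `G̃`, where `μ_n` acts by
translation. Such a function vanishes off the free orbits and is arbitrary on representatives of
these; the orbits are the fibers over the conjugacy classes `C` of `G`, and freeness means that
`C` splits into `n` classes.
-/

section GrothendieckGroup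

open Algebra (GrothendieckAddGroup)

/-- The Grothendieck group of a commutative monoid embedded in a group `H` which it generates. -/
noncomputable def grothendieckAddGroupEquivOfInjective {M H : Type*} [AddCommMonoid M]
    [AddCommGroup H] (f : M →+ H) (hf : Function.Injective f)
    (hgen : ∀ h : H, ∃ a b : M, h + f b = f a) : GrothendieckAddGroup M ≃+ H :=
  (AddLocalization.addMonoidOf ⊤).addEquivOfLocalizations
    { f with
      isLocalizationMap :=
        { map_addUnits := fun _ => AddGroup.isAddUnit _
          surj := fun h =>
            let ⟨a, b, hab⟩ := hgen h
            ⟨(a, ⟨b, trivial⟩), hab⟩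
          exists_of_eq := fun hxy => ⟨0, congrArg _ (hf hxy)⟩ } }

/-- Functoriality of the Grothendieck group for isomorphisms. -/
noncomputable def grothendieckAddGroupCongr {M N : Type*} [AddCommMonoid M] [AddCommMonoid N]
    (e : M ≃+ N) : GrothendieckAddGroup M ≃+ GrothendieckAddGroup N :=
  (AddLocalization.addMonoidOf ⊤).addEquivOfAddEquiv (AddLocalization.addMonoidOf ⊤)
    (AddSubmonoid.map_equiv_top e)

theorem grothendieckAddGroupCongr_of {M N : Type*} [AddCommMonoid M] [AddCommMonoid N]
    (e : M ≃+ N) (m : M) :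
    grothendieckAddGroupCongr e (GrothendieckAddGroup.of m) = GrothendieckAddGroup.of (e m) :=
  AddSubmonoid.LocalizationMap.addEquivOfAddEquiv_eq _ _ _

/-- The Grothendieck group of `ℕ^ι` is `ℤ^ι`. -/
noncomputable def grothendieckAddGroupPiNatEquiv (ι : Type*) :
    GrothendieckAddGroup (ι → ℕ) ≃+ (ι → ℤ) :=
  grothendieckAddGroupEquivOfInjective ((Nat.castAddMonoidHom ℤ).compLeft ι)
    (fun _ _ h => funext fun i => Nat.cast_injective (R := ℤ) (congrFun h i)) fun c =>
      ⟨fun i => (c i).toNat, fun i => (-c i).toNat, funext fun i => by simp; lia⟩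

theorem bijective_of_closure_range_eq_top {ι M : Type*} [Finite ι] [DecidableEq ι] [AddCommMonoid M]
    (f : M →+ (ι → ℕ)) (b : ι → M) (hb : AddSubmonoid.closure (Set.range b) = ⊤)
    (hf : ∀ i, f (b i) = Pi.single i 1) : Function.Bijective f := by
  have := Fintype.ofFinite ι
  let g : (ι → ℕ) →+ M := ∑ i, (multiplesHom M (b i)).comp (Pi.evalAddMonoidHom _ i)
  have hg (i : ι) : g (Pi.single i 1) = b i := by
    simp [g, AddMonoidHom.finsetSum_apply, Pi.single_apply]
  have hgf : g.comp f = .id M := by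
    refine AddMonoidHom.eq_of_eqOn_denseM hb ?_
    rintro _ ⟨i, rfl⟩
    simp [hf, hg]
  have hfg : f.comp g = .id (ι → ℕ) := by
    refine AddMonoidHom.functions_ext' _ _ _ fun i => AddMonoidHom.ext_nat ?_
    simp [hf, hg]
  exact Function.bijective_iff_has_inverse.2
    ⟨g, DFunLike.congr_fun hgf, DFunLike.congr_fun hfg⟩

end GrothendieckGroup

/-! ### The group `K(R)` of a semisimple algebra -/

section Semisimple

open Module

variable {R : Type u} [Ring R]

theorem subsingleton_hom_of_isEmpty_linearEquiv {S T : Type*} [AddCommGroup S] [Module R S]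
    [AddCommGroup T] [Module R T] [IsSimpleModule R S] [IsSimpleModule R T]
    (h : IsEmpty (S ≃ₗ[R] T)) : Subsingleton (S →ₗ[R] T) :=
  subsingleton_of_forall_eq 0 fun f => f.bijective_or_eq_zero.resolve_left fun hf =>
    h.false (.ofBijective f hf)

/-- A simple left ideal representing the isotypic component `c` of `R`. -/
noncomputable def simpleIdeal (c : isotypicComponents R R) : Ideal R := c.2.choose

instance (c : isotypicComponents R R) : IsSimpleModule R (simpleIdeal c) := c.2.choose_spec.1

theorem isotypicComponent_simpleIdeal (c : isotypicComponents R R) :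
    isotypicComponent R R (simpleIdeal c) = c := c.2.choose_spec.2.symm

theorem eq_of_simpleIdeal_linearEquiv {c d : isotypicComponents R R}
    (e : simpleIdeal c ≃ₗ[R] simpleIdeal d) : c = d :=
  Subtype.ext <| by
    rw [← isotypicComponent_simpleIdeal c, ← isotypicComponent_simpleIdeal d,
      e.isotypicComponent_eq]

theorem exists_linearEquiv_simpleIdeal [IsSemisimpleRing R] (T : Type*) [AddCommGroup T]
    [Module R T] [IsSimpleModule R T] :
    ∃ c : isotypicComponents R R, Nonempty (T ≃ₗ[R] simpleIdeal c) := by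
  obtain ⟨I, ⟨e⟩⟩ := IsSemisimpleRing.exists_linearEquiv_ideal_of_isSimpleModule R T
  have : IsSimpleModule R I := IsSimpleModule.congr e.symm
  let c : isotypicComponents R R := ⟨isotypicComponent R R I, I, inferInstance, rfl⟩
  obtain ⟨f⟩ := isIsotypicOfType_submodule_iff.1 (IsIsotypicOfType.isotypicComponent R R _) I <|
    I.le_isotypicComponent.trans (isotypicComponent_simpleIdeal c).ge
  exact ⟨c, ⟨e.trans f⟩⟩

namespace ProjMod

instance {ι : Type*} [Finite ι] (S : ι → ProjMod R) :
    Module.Projective R (Π i, (S i).carrier) := by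
  classical
  have := Fintype.ofFinite ι
  exact .of_equiv DFinsupp.linearEquivFunOnFintype

theorem toIsoClass_eq_sum {n : ℕ} (M : ProjMod R) (S : Fin n → ProjMod R)
    (e : M.carrier ≃ₗ[R] Π i, (S i).carrier) : M.toIsoClass = ∑ i, (S i).toIsoClass := by
  induction n generalizing M with
  | zero => exact Quotient.sound ⟨e.trans (LinearEquiv.ofSubsingleton _ PUnit.{u + 1})⟩
  | succ n ih =>
    let tail : ProjMod R := ⟨Π i : Fin n, (S i.succ).carrier⟩
    rw [Fin.sum_univ_succ, ← ih tail (fun i => S i.succ) (LinearEquiv.refl R _)]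
    exact Quotient.sound ⟨e.trans (Fin.consLinearEquiv R fun i => (S i).carrier).symm⟩

variable [IsSemisimpleRing R]

/-- The isomorphism class of the simple module attached to the isotypic component `c`. -/
noncomputable def simpleClass (c : isotypicComponents R R) : IsoClass R :=
  have : Module.Projective R (simpleIdeal c) := Module.projective_of_isSemisimpleRing R _
  toIsoClass ⟨simpleIdeal c⟩

theorem closure_range_simpleClass :
    AddSubmonoid.closure (Set.range (simpleClass (R := R))) = ⊤ := by
  refine eq_top_iff.2 fun x _ => ?_
  induction x using Quotient.inductionOn with | _ M =>
  obtain ⟨n, S, e, hS⟩ := IsSemisimpleModule.exists_linearEquiv_fin_dfinsupp R M.carrier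
  have (i : Fin n) : Module.Projective R (S i) := Module.projective_of_isSemisimpleRing R _
  change M.toIsoClass ∈ _
  rw [M.toIsoClass_eq_sum (fun i => ⟨S i⟩) (e.trans DFinsupp.linearEquivFunOnFintype)]
  refine sum_mem fun i _ => AddSubmonoid.subset_closure ?_
  obtain ⟨c, ⟨f⟩⟩ := exists_linearEquiv_simpleIdeal (R := R) (S i)
  exact ⟨c, Quotient.sound ⟨f.symm⟩⟩

end ProjMod

end Semisimple

section Multiplicity

open Module

variable (F : Type*) [Field F] {R : Type u} [Ring R] [Algebra F R] [Module.Finite F R]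

theorem finrank_hom_eq_one_of_isSimpleModule [IsAlgClosed F] {S T : Type*} [AddCommGroup S]
    [Module R S] [AddCommGroup T] [Module R T] [Module F T] [IsScalarTower F R T]
    [IsSimpleModule R T] (e : S ≃ₗ[R] T) : finrank F (S →ₗ[R] T) = 1 := by
  have : Module.Finite F T := Module.Finite.trans R T
  rw [(e.congrLeft T F).finrank_eq,
    ← (LinearEquiv.ofBijective (Algebra.linearMap F (Module.End R T))
      (IsSimpleModule.algebraMap_end_bijective_of_isAlgClosed F)).finrank_eq, finrank_self]

theorem finite_linearMap (M T : Type*) [AddCommGroup M] [Module R M] [Module.Finite R M]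
    [AddCommGroup T] [Module R T] [Module F T] [IsScalarTower F R T] [Module.Finite R T] :
    Module.Finite F (M →ₗ[R] T) := by
  obtain ⟨s, hs⟩ := Module.Finite.fg_top (R := R) (M := M)
  have : Module.Finite F T := Module.Finite.trans R T
  exact .of_injective (LinearMap.pi fun x : s => LinearMap.applyₗ' F (x : M)) fun f g h =>
    LinearMap.ext_on hs fun x hx => congrFun h ⟨x, hx⟩

namespace ProjMod

/-- The multiplicity of each simple module `S` in a module `M`, computed as `dim_F Hom_R(M, S)`. -/
noncomputable def multiplicity :
    IsoClass R →+ (isotypicComponents R R → ℕ) where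
  toFun := Quotient.lift (fun M c => finrank F (M.carrier →ₗ[R] simpleIdeal c))
    fun M N ⟨e⟩ => funext fun c => (e.congrLeft (simpleIdeal c) F).finrank_eq
  map_zero' := funext fun c =>
    have : Subsingleton (zeroMod (R := R)).carrier := inferInstanceAs (Subsingleton PUnit)
    finrank_zero_of_subsingleton
  map_add' := by
    rintro ⟨M⟩ ⟨N⟩
    funext c
    have := finite_linearMap F (R := R) M.carrier (simpleIdeal c)
    have := finite_linearMap F (R := R) N.carrier (simpleIdeal c)
    exact (LinearMap.coprodEquiv F).symm.finrank_eq.trans finrank_prod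

variable [IsSemisimpleRing R] [IsAlgClosed F]

open scoped Classical in
theorem multiplicity_simpleClass (c : isotypicComponents R R) :
    multiplicity F (simpleClass c) = Pi.single c 1 := by
  funext d
  change finrank F (simpleIdeal c →ₗ[R] simpleIdeal d) = _
  obtain rfl | hdc := eq_or_ne d c
  · rw [Pi.single_eq_same, finrank_hom_eq_one_of_isSimpleModule F (.refl R _)]
  · have := subsingleton_hom_of_isEmpty_linearEquiv (R := R) (S := simpleIdeal c)
      ⟨fun e => hdc (eq_of_simpleIdeal_linearEquiv e).symm⟩
    rw [Pi.single_eq_of_ne hdc, finrank_zero_of_subsingleton]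

theorem bijective_multiplicity : Function.Bijective (multiplicity F (R := R)) := by
  classical
  exact bijective_of_closure_range_eq_top _ simpleClass closure_range_simpleClass
    (multiplicity_simpleClass F)

end ProjMod

/-- The group `K(R)` of a finite-dimensional semisimple algebra over an algebraically closed field
is free on the classes of the simple modules; these are indexed by the isotypic components of `R`.
-/
noncomputable def KGroup.equivPiInt [IsSemisimpleRing R] [IsAlgClosed F] :
    KGroup R ≃+ (isotypicComponents R R → ℤ) :=
  (grothendieckAddGroupCongr (.ofBijective _ (ProjMod.bijective_multiplicity F))).trans
    (grothendieckAddGroupPiNatEquiv _)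

end Multiplicity

section Center

open Module

variable (F : Type*) [Field F]

theorem finrank_center_congr {A B : Type*} [Ring A] [Ring B] [Algebra F A] [Algebra F B]
    (e : A ≃ₗ[F] B) (he : ∀ x, e x ∈ Set.center B ↔ x ∈ Set.center A) :
    finrank F (Subalgebra.center F A) = finrank F (Subalgebra.center F B) := by
  have h : (Subalgebra.toSubmodule (Subalgebra.center F B)).comap (e : A →ₗ[F] B) =
      Subalgebra.toSubmodule (Subalgebra.center F A) := Submodule.ext he
  rw [← Subalgebra.finrank_toSubmodule, ← h]
  exact (e.ofSubmodule' (Subalgebra.toSubmodule (Subalgebra.center F B))).finrank_eq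

theorem finrank_center_pi {ι : Type*} [Finite ι] (D : ι → Type*) [∀ i, Ring (D i)]
    [∀ i, Algebra F (D i)] [∀ i, Nontrivial (D i)] [∀ i, Algebra.IsCentral F (D i)] :
    finrank F (Subalgebra.center F (Π i, D i)) = Nat.card ι := by
  have := Fintype.ofFinite ι
  let φ : (ι → F) →ₗ[F] Π i, D i := LinearMap.piMap fun i => Algebra.linearMap F (D i)
  have hφ : Function.Injective φ :=
    Function.Injective.piMap fun i => (algebraMap F (D i)).injective
  have hr : LinearMap.range φ = Subalgebra.toSubmodule (Subalgebra.center F (Π i, D i)) := by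
    ext x
    simp only [Subalgebra.center_pi, Algebra.IsCentral.center_eq_bot]
    simp [Algebra.mem_bot, φ, funext_iff, LinearMap.mem_range, Classical.skolem]
  rw [← Subalgebra.finrank_toSubmodule, ← hr, LinearMap.finrank_range_of_inj hφ,
    finrank_fintype_fun_eq_card, Nat.card_eq_fintype_card]

variable {R : Type*} [Ring R] [Algebra F R] [Module.Finite F R] [IsAlgClosed F]

theorem isCentral_end_of_isSimpleModule (S : Type*) [AddCommGroup S] [Module R S] [Module F S]
    [IsScalarTower F R S] [IsSimpleModule R S] : Algebra.IsCentral F (Module.End R S) where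
  out f _ :=
    have : Module.Finite F S := Module.Finite.trans R S
    (IsSimpleModule.algebraMap_end_bijective_of_isAlgClosed F).surjective f

variable [IsSemisimpleRing R]

theorem isCentral_end_isotypicComponent (c : isotypicComponents R R) :
    Algebra.IsCentral F (Module.End R (c : Ideal R)) := by
  obtain ⟨n, _, S, _, _, ⟨e⟩⟩ :=
    IsIsotypic.submodule_linearEquiv_fun (IsIsotypic.isotypicComponents c.2)
  have := isCentral_end_of_isSimpleModule F (R := R) S
  exact .of_algEquiv F _ _ ((e.conjAlgEquiv F).trans (endVecAlgEquivMatrixEnd (Fin n) F R S)).symm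

variable (R) in
theorem finrank_center_eq_card_isotypicComponents :
    finrank F (Subalgebra.center F R) = Nat.card (isotypicComponents R R) := by
  classical
  have (c : isotypicComponents R R) := isCentral_end_isotypicComponent F c
  let e := (AlgEquiv.moduleEndSelf F).trans (IsSemisimpleModule.endAlgEquiv F R R)
  have he (x : R) : e (.op x) ∈ Set.center _ ↔ x ∈ Set.center R :=
    (MulEquivClass.apply_mem_center_iff e).trans MulOpposite.op_mem_center_iff
  rw [finrank_center_congr F ((MulOpposite.opLinearEquiv F).trans e.toLinearEquiv) he,
    finrank_center_pi]
end Center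

namespace KGroup

open Module

variable (F R : Type*) [Field F] [Ring R] [Algebra F R] [Module.Finite F R] [IsSemisimpleRing R]
  [IsAlgClosed F]

include F in
theorem free : Module.Free ℤ (KGroup R) :=
  .of_equiv (equivPiInt F (R := R)).symm.toIntLinearEquiv

include F in
theorem finite : Module.Finite ℤ (KGroup R) :=
  .equiv (equivPiInt F (R := R)).symm.toIntLinearEquiv

theorem finrank_eq : finrank ℤ (KGroup R) = finrank F (Subalgebra.center F R) := by
  have := Fintype.ofFinite (isotypicComponents R R)
  rw [(equivPiInt F (R := R)).toIntLinearEquiv.finrank_eq, finrank_fintype_fun_eq_card,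
    finrank_center_eq_card_isotypicComponents, Nat.card_eq_fintype_card]

end KGroup

/-! ### Equivariant modules and crossed products -/

namespace CrossedProduct

open SkewMonoidAlgebra

variable {G : Type u} {A : Type v} [Group G] [Ring A] [MulSemiringAction G A]
  {M N : Type*} [AddCommGroup M] [AddCommGroup N]
  [Module (CrossedProduct G A) M] [Module (CrossedProduct G A) N]

theorem single_eq_mul (g : G) (a : A) :
    (single g a : CrossedProduct G A) = single 1 a * single g 1 := by
  simp

theorem map_smul_of_single (f : M →+ N)
    (hA : ∀ (a : A) m, f ((single 1 a : CrossedProduct G A) • m) =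
      (single 1 a : CrossedProduct G A) • f m)
    (hG : ∀ (g : G) m, f ((single g 1 : CrossedProduct G A) • m) =
      (single g 1 : CrossedProduct G A) • f m)
    (r : CrossedProduct G A) (m : M) : f (r • m) = r • f m := by
  induction r using SkewMonoidAlgebra.induction_on' with
  | single g a => rw [single_eq_mul, mul_smul, mul_smul, hA, hG]
  | add x y hx hy => rw [add_smul, add_smul, map_add, hx, hy]

theorem smul_eq_single_mul (a : A) (r : CrossedProduct G A) : a • r = single 1 a * r := by
  ext g
  simp

theorem isScalarTower_of_single_smul [Module A M]
    (h : ∀ (a : A) (m : M), (single 1 a : CrossedProduct G A) • m = a • m) :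
    IsScalarTower A (CrossedProduct G A) M where
  smul_assoc a r m := by rw [smul_eq_single_mul, mul_smul, h]

variable [Module A M] [IsScalarTower A (CrossedProduct G A) M]
  [Module A N] [IsScalarTower A (CrossedProduct G A) N]

theorem single_one_smul (a : A) (m : M) : (single 1 a : CrossedProduct G A) • m = a • m := by
  rw [← mul_one (single 1 a), ← smul_eq_single_mul, smul_assoc, one_smul]

theorem single_smul_smul (g : G) (a : A) (m : M) :
    (single g 1 : CrossedProduct G A) • a • m =
      (g • a) • (single g 1 : CrossedProduct G A) • m := by
  rw [← single_one_smul (G := G) a m, ← single_one_smul (G := G) (g • a), smul_smul, smul_smul]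
  simp

/-- The sum `∑ g f g⁻¹` of the `G`-translates of an `A`-linear map. -/
noncomputable def average [Fintype G] (f : M →ₗ[A] N) : M →ₗ[CrossedProduct G A] N :=
  let φ : M →+ N := AddMonoidHom.mk'
    (fun m => ∑ g : G, (single g 1 : CrossedProduct G A) •
      f ((single g⁻¹ 1 : CrossedProduct G A) • m))
    fun m m' => by simp only [smul_add, map_add, Finset.sum_add_distrib]
  { φ with
    map_smul' := map_smul_of_single φ
      (fun a m => by simp [φ, single_one_smul, single_smul_smul, Finset.smul_sum])
      fun h m => by
        simp only [φ, AddMonoidHom.mk'_apply, Finset.smul_sum]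
        exact Fintype.sum_equiv (Equiv.mulLeft h⁻¹) _ _ fun g => by simp [smul_smul] }

theorem average_apply [Fintype G] (f : M →ₗ[A] N) (m : M) :
    average (G := G) f m = ∑ g : G, (single g 1 : CrossedProduct G A) •
      f ((single g⁻¹ 1 : CrossedProduct G A) • m) := rfl

theorem map_average [Fintype G] (p : N →ₗ[CrossedProduct G A] M) {s : M →ₗ[A] N}
    (hs : ∀ m, p (s m) = m) (m : M) : p (average (G := G) s m) = Fintype.card G • m := by
  simp [average_apply, hs, smul_smul]

theorem exists_section [Finite G] (hG : IsUnit (Nat.card G : A)) (p : N →ₗ[CrossedProduct G A] M)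
    {s : M →ₗ[A] N} (hs : ∀ m, p (s m) = m) :
    ∃ σ : M →ₗ[CrossedProduct G A] N, p ∘ₗ σ = LinearMap.id := by
  have := Fintype.ofFinite G
  have hb : Function.Bijective (p ∘ₗ average (G := G) s) := by
    convert hG.smul_bijective (β := M) using 1
    funext m
    simp [map_average p hs, Nat.cast_smul_eq_nsmul]
  let e := LinearEquiv.ofBijective _ hb
  exact ⟨average s ∘ₗ e.symm, LinearMap.ext e.apply_symm_apply⟩

variable (G M)

theorem projective_restrictScalars [Module.Projective (CrossedProduct G A) M] :
    Module.Projective A M := by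
  obtain ⟨s, hs⟩ := Module.projective_def'.1 ‹Module.Projective (CrossedProduct G A) M›
  exact .of_split (s.restrictScalars A) ((Finsupp.linearCombination _ id).restrictScalars A)
    (LinearMap.ext fun m => LinearMap.congr_fun hs m)

theorem projective_of_restrictScalars [Finite G] (hG : IsUnit (Nat.card G : A))
    [Module.Projective A M] : Module.Projective (CrossedProduct G A) M := by
  let p : (M →₀ CrossedProduct G A) →ₗ[CrossedProduct G A] M := Finsupp.linearCombination _ id
  obtain ⟨s, hs⟩ := Module.projective_lifting_property (p.restrictScalars A) LinearMap.id
    (Finsupp.linearCombination_id_surjective _ M)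
  obtain ⟨σ, hσ⟩ := exists_section hG p (LinearMap.congr_fun hs)
  exact .of_split σ p hσ

theorem isSemisimpleRing [Finite G] [IsSemisimpleRing A] (hG : IsUnit (Nat.card G : A)) :
    IsSemisimpleRing (CrossedProduct G A) where
  exists_isCompl I := by
    have : Module.Projective A (CrossedProduct G A ⧸ I) := Module.projective_of_isSemisimpleRing A _
    have := projective_of_restrictScalars G (CrossedProduct G A ⧸ I) hG
    obtain ⟨σ, hσ⟩ := Module.projective_lifting_property I.mkQ LinearMap.id I.mkQ_surjective
    have hσ' (x : CrossedProduct G A) : I.mkQ (x - σ (I.mkQ x)) = 0 := by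
      rw [map_sub, ← LinearMap.comp_apply, hσ]; exact sub_self _
    let f : CrossedProduct G A →ₗ[CrossedProduct G A] I :=
      (LinearMap.id - σ ∘ₗ I.mkQ).codRestrict I fun x => (Submodule.Quotient.mk_eq_zero I).1 (hσ' x)
    refine ⟨LinearMap.ker f, LinearMap.isCompl_of_proj (f := f) fun x => Subtype.ext ?_⟩
    simp [f, (Submodule.Quotient.mk_eq_zero I).2 x.2]

end CrossedProduct

namespace SameModule

variable {G : Type u} {A : Type v} [Group G] [Ring A] [MulSemiringAction G A]
  {E E' : EquivProjMod G A} {M M' : ProjMod (CrossedProduct G A)}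

theorem moduleIso_of_equivIso (h : SameModule E M) (h' : SameModule E' M') (hE : E ≈ E') :
    M ≈ M' := by
  obtain ⟨φ, hA, hG⟩ := h
  obtain ⟨φ', hA', hG'⟩ := h'
  obtain ⟨ψ, hψ⟩ := hE
  let θ : M.carrier ≃+ M'.carrier := (φ.symm.trans ψ.toAddEquiv).trans φ'
  refine ⟨{ θ with map_smul' := CrossedProduct.map_smul_of_single θ.toAddMonoidHom ?_ ?_ }⟩
  · exact fun a => φ.surjective.forall.2 fun e => by simp [θ, ← hA, ← hA']
  · exact fun g => φ.surjective.forall.2 fun e => by simp [θ, ← hG, ← hG', hψ]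

theorem equivIso_of_moduleIso (h : SameModule E M) (h' : SameModule E' M') (hM : M ≈ M') :
    E ≈ E' := by
  obtain ⟨φ, hA, hG⟩ := h
  obtain ⟨φ', hA', hG'⟩ := h'
  obtain ⟨ψ⟩ := hM
  let θ : E.carrier ≃+ E'.carrier := (φ.trans ψ.toAddEquiv).trans φ'.symm
  exact ⟨{ θ with map_smul' := fun a e => φ'.injective (by simp [θ, hA, hA']) },
    fun g e => φ'.injective (show φ' (θ (g • e)) = φ' (g • θ e) by simp [θ, hG, hG'])⟩

theorem dsum (h : SameModule E M) (h' : SameModule E' M') :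
    SameModule (E.dsum E') (M.dsum M') := by
  obtain ⟨φ, hA, hG⟩ := h
  obtain ⟨φ', hA', hG'⟩ := h'
  exact ⟨φ.prodCongr φ', fun a e => Prod.ext (hA a e.1) (hA' a e.2),
    fun g e => Prod.ext (hG g e.1) (hG' g e.2)⟩

end SameModule

section EquivariantModule

open SkewMonoidAlgebra

variable {G : Type u} {A : Type v} [Group G] [Ring A] [MulSemiringAction G A]

namespace EquivProjMod

/-- The action of `G ⋉ A` on an equivariant module. -/
noncomputable def crossedProductToEnd (E : EquivProjMod G A) :
    CrossedProduct G A →+* AddMonoid.End E.carrier :=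
  liftNCRingHom (Module.toAddMonoidEnd A E.carrier) (DistribMulAction.toAddMonoidEnd G E.carrier)
    fun {a g} => AddMonoidHom.ext fun e => (E.smul_smul' g a e).symm

theorem crossedProductToEnd_single (E : EquivProjMod G A) (g : G) (a : A)
    (e : E.carrier) : E.crossedProductToEnd (single g a) e = a • g • e :=
  congrArg (fun f : AddMonoid.End E.carrier => f e) <|
    liftNC_single (Module.toAddMonoidEnd A E.carrier : A →+ AddMonoid.End E.carrier) _ g a

theorem exists_sameModule [Finite G] (hG : IsUnit (Nat.card G : A))
    (E : EquivProjMod G A) : ∃ M : ProjMod (CrossedProduct G A), SameModule E M := by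
  let : Module (CrossedProduct G A) E.carrier := Module.compHom _ E.crossedProductToEnd
  have hs (g : G) (a : A) (e : E.carrier) : (single g a : CrossedProduct G A) • e = a • g • e :=
    E.crossedProductToEnd_single g a e
  have : IsScalarTower A (CrossedProduct G A) E.carrier :=
    CrossedProduct.isScalarTower_of_single_smul fun a e =>
      (hs 1 a e).trans (congrArg _ (one_smul G e))
  have : Module.Finite (CrossedProduct G A) E.carrier := .of_restrictScalars_finite A _ _
  have := CrossedProduct.projective_of_restrictScalars G E.carrier hG
  exact ⟨⟨E.carrier⟩, AddEquiv.refl _,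
    fun a e => (CrossedProduct.single_one_smul (G := G) a e).symm,
    fun g e => ((hs g 1 e).trans (one_smul A _)).symm⟩

end EquivProjMod

theorem ProjMod.exists_sameModule [Finite G] (M : ProjMod (CrossedProduct G A)) :
    ∃ E : EquivProjMod G A, SameModule E M := by
  let : Module A M.carrier := Module.compHom _ (singleOneRingHom : A →+* CrossedProduct G A)
  let : DistribMulAction G M.carrier := DistribMulAction.compHom _ (SkewMonoidAlgebra.of A G)
  have : IsScalarTower A (CrossedProduct G A) M.carrier :=
    CrossedProduct.isScalarTower_of_single_smul fun _ _ => rfl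
  have : Module.Finite A (CrossedProduct G A) :=
    Module.Finite.equiv (coeffLinearEquiv (k := A) (G := G) (S := A)).symm
  have : Module.Finite A M.carrier := Module.Finite.trans (CrossedProduct G A) _
  have : Module.Projective A M.carrier := CrossedProduct.projective_restrictScalars G M.carrier
  exact ⟨{ carrier := M.carrier, smul_smul' := CrossedProduct.single_smul_smul }, AddEquiv.refl _,
    fun _ _ => rfl, fun _ _ => rfl⟩

theorem EquivProjMod.exists_isoClass_addEquiv [Finite G] (hG : IsUnit (Nat.card G : A)) :
    ∃ e : EquivProjMod.IsoClass G A ≃+ ProjMod.IsoClass (CrossedProduct G A),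
      ∀ E M, SameModule E M → e E.toIsoClass = M.toIsoClass := by
  choose f hf using EquivProjMod.exists_sameModule (G := G) (A := A) hG
  let F : EquivProjMod.IsoClass G A → ProjMod.IsoClass (CrossedProduct G A) :=
    Quotient.map f fun E E' => SameModule.moduleIso_of_equivIso (hf E) (hf E')
  have hF (E : EquivProjMod G A) (M) (h : SameModule E M) : F E.toIsoClass = M.toIsoClass :=
    Quotient.sound ((hf E).moduleIso_of_equivIso h (Setoid.refl E))
  have hbij : Function.Bijective F := by
    refine ⟨?_, Quotient.ind fun M => ?_⟩
    · refine Quotient.ind₂ fun E E' h => ?_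
      exact Quotient.sound ((hf E).equivIso_of_moduleIso (hf E') (Quotient.exact h))
    · obtain ⟨E, hE⟩ := M.exists_sameModule
      exact ⟨E.toIsoClass, hF E M hE⟩
  exact ⟨{ Equiv.ofBijective F hbij with
    map_add' := Quotient.ind₂ fun E E' => hF (E.dsum E') _ ((hf E).dsum (hf E')) }, hF⟩

theorem EquivKGroup.exists_addEquiv [Finite G] (hG : IsUnit (Nat.card G : A)) :
    ∃ Φ : EquivKGroup G A ≃+ KGroup (CrossedProduct G A),
      ∀ E M, SameModule E M → Φ E.toK = M.toK := by
  obtain ⟨e, he⟩ := EquivProjMod.exists_isoClass_addEquiv hG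
  exact ⟨grothendieckAddGroupCongr e, fun E M h =>
    (grothendieckAddGroupCongr_of e _).trans (congrArg _ (he E M h))⟩

end EquivariantModule

/-! ### Lifting automorphisms to `SU(n)` -/

section SpecialUnitary

variable {ι : Type*} [Fintype ι] [DecidableEq ι]

theorem exists_eq_conjStarAlgAut {𝕜 : Type*} [RCLike 𝕜]
    (f : Matrix ι ι 𝕜 ≃⋆ₐ[𝕜] Matrix ι ι 𝕜) :
    ∃ t : Matrix.unitaryGroup ι 𝕜, f = Unitary.conjStarAlgAut 𝕜 (Matrix ι ι 𝕜) t := by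
  let e := Matrix.toEuclideanCLM (n := ι) (𝕜 := 𝕜)
  let f' := e.symm.trans (f.trans e)
  obtain ⟨T, hT⟩ := f'.eq_linearIsometryEquivConjStarAlgEquiv
    (LinearMap.continuous_of_finiteDimensional f'.toAlgEquiv.toLinearMap)
  rw [← Unitary.conjStarAlgAut_symm_unitaryLinearIsometryEquiv] at hT
  let t := Unitary.linearIsometryEquiv.symm T
  refine ⟨⟨e.symm t, Unitary.map_mem e.symm t.2⟩, StarAlgEquiv.ext fun a => e.injective ?_⟩
  calc e (f a) = f' (e a) := congrArg (fun b => e (f b)) (e.symm_apply_apply a).symm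
    _ = t * e a * star (t : EuclideanSpace 𝕜 ι →L[𝕜] EuclideanSpace 𝕜 ι) :=
      DFunLike.congr_fun hT (e a)
    _ = e (e.symm t * a * star (e.symm t)) := by
      simp only [map_mul, map_star, StarAlgEquiv.apply_symm_apply]

theorem exists_smul_mem_specialUnitaryGroup [Nonempty ι] {t : Matrix ι ι ℂ}
    (ht : t ∈ Matrix.unitaryGroup ι ℂ) :
    ∃ w : unitary ℂ, w • t ∈ Matrix.specialUnitaryGroup ι ℂ := by
  obtain ⟨w, hw⟩ := IsAlgClosed.exists_pow_nat_eq (star t.det) (Fintype.card_pos (α := ι))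
  have hdet := Matrix.det_of_mem_unitary ht
  have hnorm : ‖w‖ = 1 := by
    rw [← pow_eq_one_iff_of_nonneg (norm_nonneg w) (Fintype.card_ne_zero (α := ι)),
      ← norm_pow, hw, norm_star, CStarRing.norm_of_mem_unitary hdet]
  have hw' : w ∈ unitary ℂ := by
    rw [Unitary.mem_iff_self_mul_star]
    simp [Complex.mul_conj, Complex.normSq_eq_norm_sq, hnorm]
  refine ⟨⟨w, hw'⟩, Matrix.mem_specialUnitaryGroup_iff.2 ⟨Unitary.smul_mem _ ht, ?_⟩⟩
  change (w • t).det = 1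
  rw [Matrix.det_smul, hw, Unitary.star_mul_self_of_mem hdet]

end SpecialUnitary

theorem TildeGroup.proj_surjective {G : Type u} [Group G] (n : ℕ) [NeZero n]
    [MulSemiringAction G (MatC n)] [SMulCommClass G ℂ (MatC n)]
    (hstar : ∀ (g : G) (a : MatC n), g • star a = star (g • a)) :
    Function.Surjective (TildeGroup.proj G n) := by
  intro g
  obtain ⟨t, ht⟩ := exists_eq_conjStarAlgAut
    (StarAlgEquiv.ofAlgEquiv (MulSemiringAction.toAlgEquiv ℂ (MatC n) g) (hstar g))
  obtain ⟨w, hw⟩ := exists_smul_mem_specialUnitaryGroup t.2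
  refine ⟨⟨(g, ⟨_, hw⟩), fun a => ?_⟩, rfl⟩
  have h := (Unitary.conjStarAlgAut_ext_iff' (w • t) t).2 ⟨w, rfl⟩
  exact DFunLike.congr_fun (ht.trans h.symm) a

/-! ### Functions of linear type -/

section EquivariantFun

open MulAction

variable {F M X Y : Type*} [Field F] [Group M] [MulAction M X] (χ : M →* Fˣ)

/-- The `F`-valued functions on `X` on which `M` acts through the character `χ`. -/
def equivariantFun : Submodule F (X → F) where
  carrier := {f | ∀ (m : M) x, f (m • x) = χ m * f x}
  zero_mem' m x := by simp
  add_mem' hf hg m x := by simp [hf m x, hg m x, mul_add]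
  smul_mem' c f hf m x := by simp [hf m x, mul_left_comm]

variable {χ}

theorem apply_eq_zero_of_mem_equivariantFun {f : X → F} (hf : f ∈ equivariantFun χ) {x : X}
    (hx : ¬ stabilizer M x ≤ χ.ker) : f x = 0 := by
  obtain ⟨m, hm, hχ⟩ := SetLike.not_le_iff_exists.1 hx
  have h : f x = χ m * f x := by rw [← hf m x, mem_stabilizer_iff.1 hm]
  by_contra h0
  exact hχ (Units.ext ((right_eq_mul₀ h0).1 h))

theorem eq_of_smul_eq_smul_of_stabilizer_le {x : X} (hx : stabilizer M x ≤ χ.ker) {m m' : M}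
    (h : m • x = m' • x) : χ m = χ m' := by
  have hmem : m'⁻¹ * m ∈ stabilizer M x := by
    rw [mem_stabilizer_iff, mul_smul, h, inv_smul_smul]
  have hχ := hx hmem
  rwa [MonoidHom.mem_ker, map_mul, map_inv, inv_mul_eq_one, eq_comm] at hχ

variable {p : X → Y} {s : Y → X}

theorem exists_mem_equivariantFun (hp : ∀ (m : M) x, p (m • x) = p x)
    (hs : Function.RightInverse s p) (horb : ∀ x, x ∈ orbit M (s (p x))) {c : Y → F}
    (hc : ∀ y, c y ≠ 0 → stabilizer M (s y) ≤ χ.ker) :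
    ∃ f ∈ equivariantFun χ, ∀ y, f (s y) = c y := by
  choose t ht using horb
  dsimp only at ht
  have key {m x} (h : m • s (p x) = x) : χ (t x) * c (p x) = χ m * c (p x) := by
    obtain h0 | h0 := eq_or_ne (c (p x)) 0
    · rw [h0, mul_zero, mul_zero]
    · rw [eq_of_smul_eq_smul_of_stabilizer_le (hc _ h0) ((ht x).trans h.symm)]
  refine ⟨fun x => χ (t x) * c (p x), fun m x => ?_, fun y => ?_⟩
  · beta_reduce
    rw [key (m := m * t x) (by rw [hp, mul_smul, ht]), hp, map_mul, Units.val_mul, mul_assoc]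
  · beta_reduce
    rw [key (m := 1) (by rw [hs, one_smul]), hs, map_one, Units.val_one, one_mul]

/-- If `s` is a system of representatives of the orbits, then an equivariant function is
determined by its arbitrary values at those representatives on whose stabilizer `χ` is trivial. -/
noncomputable def equivariantFunEquiv (hp : ∀ (m : M) x, p (m • x) = p x)
    (hs : Function.RightInverse s p) (horb : ∀ x, x ∈ orbit M (s (p x))) :
    equivariantFun (X := X) χ ≃ₗ[F] ({y // stabilizer M (s y) ≤ χ.ker} → F) :=
  .ofBijective (LinearMap.funLeft F F (fun y => s y.1) ∘ₗ (equivariantFun χ).subtype) <| by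
    refine ⟨(injective_iff_map_eq_zero _).2 fun ⟨f, hf⟩ h0 => Subtype.ext (funext fun x => ?_),
      fun c => ?_⟩
    · obtain ⟨m, hm⟩ := horb x
      have hrep : f (s (p x)) = 0 := by
        by_cases h : stabilizer M (s (p x)) ≤ χ.ker
        · exact congrFun h0 ⟨p x, h⟩
        · exact apply_eq_zero_of_mem_equivariantFun hf h
      change f x = 0
      rw [← hm]
      exact (hf m _).trans (by rw [hrep, mul_zero])
    · obtain ⟨f, hf, hfc⟩ := exists_mem_equivariantFun (χ := χ) hp hs horb
        (c := Function.extend Subtype.val c 0) fun y => by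
          contrapose!
          exact fun h => Function.extend_apply' _ _ _ (by rintro ⟨y', rfl⟩; exact h y'.2)
      exact ⟨⟨f, hf⟩, funext fun y => (hfc y).trans (Subtype.val_injective.extend_apply _ _ y)⟩

theorem card_orbit_eq_card_iff [Finite M] (x : X) :
    Nat.card (orbit M x) = Nat.card M ↔ stabilizer M x = ⊥ := by
  rw [Nat.card_congr (orbitEquivQuotientStabilizer M x), ← Subgroup.index,
    ← (stabilizer M x).card_mul_index, right_eq_mul₀ (stabilizer M x).index_ne_zero_of_finite,
    Subgroup.card_eq_one]

end EquivariantFun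

namespace TildeGroup

open MulAction

variable {G : Type u} {n : ℕ} [Group G] [MulSemiringAction G (MatC n)]

/-- The unitary matrix `s` of an element `(g, s)` of `G̃`. -/
def mat : TildeGroup G n →* MatC n :=
  (Submonoid.subtype _).comp
    ((MonoidHom.snd G (Matrix.specialUnitaryGroup (Fin n) ℂ)).comp (TildeGroup G n).subtype)

theorem mat_mul_mat_inv (x : TildeGroup G n) : mat x * mat x⁻¹ = 1 := by
  rw [← map_mul, mul_inv_cancel, map_one]

theorem mat_inv_mul_mat (x : TildeGroup G n) : mat x⁻¹ * mat x = 1 := by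
  rw [← map_mul, inv_mul_cancel, map_one]

theorem proj_smul (x : TildeGroup G n) (a : MatC n) :
    proj G n x • a = mat x * a * mat x⁻¹ := x.2 a

theorem proj_smul_mul_mat (x : TildeGroup G n) (a : MatC n) :
    (proj G n x • a) * mat x = mat x * a := by
  rw [proj_smul, mul_assoc, mat_inv_mul_mat, mul_one]

variable [NeZero n]

theorem ofMu_mul (z w : rootsOfUnity n ℂ) : ofMu G n (z * w) = ofMu G n z * ofMu G n w :=
  Subtype.ext <| Prod.ext (mul_one 1).symm <|
    Subtype.ext (map_mul (Matrix.scalar (Fin n)) ((z : ℂˣ) : ℂ) ((w : ℂˣ) : ℂ))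

theorem ofMu_one : ofMu G n 1 = 1 :=
  Subtype.ext <| Prod.ext rfl <| Subtype.ext (map_one (Matrix.scalar (Fin n)))

theorem proj_ofMu_mul (z : rootsOfUnity n ℂ) (x : TildeGroup G n) :
    proj G n (ofMu G n z * x) = proj G n x := one_mul _

theorem commute_ofMu (z : rootsOfUnity n ℂ) (x : TildeGroup G n) : Commute (ofMu G n z) x :=
  Subtype.ext <| Prod.ext ((one_mul _).trans (mul_one _).symm) <|
    Subtype.ext (Matrix.scalar_commute _ (fun _ => Commute.all _ _) _).eq

theorem mul_ofMu_mul_mul_inv (z : rootsOfUnity n ℂ) (c x : TildeGroup G n) :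
    c * (ofMu G n z * x) * c⁻¹ = ofMu G n z * (c * x * c⁻¹) := by
  simp only [← mul_assoc, (commute_ofMu z c).eq]

theorem exists_eq_ofMu_of_proj_eq_one {x : TildeGroup G n} (hx : proj G n x = 1) :
    ∃ z, x = ofMu G n z := by
  have hcomm (a : MatC n) : a * mat x = mat x * a := by
    rw [← proj_smul_mul_mat, hx, one_smul]
  obtain ⟨c, hc⟩ : mat x ∈ Set.range (Matrix.scalar (Fin n)) :=
    Matrix.mem_range_scalar_of_commute_single fun i j _ => hcomm _
  have hdet : (mat x).det = 1 := (Matrix.mem_specialUnitaryGroup_iff.1 x.1.2.2).2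
  have hcn : c ^ n = 1 := by simpa [← hc] using hdet
  exact ⟨rootsOfUnity.mkOfPowEq c hcn, Subtype.ext (Prod.ext hx (Subtype.ext hc.symm))⟩

theorem exists_eq_ofMu_mul {x y : TildeGroup G n} (h : proj G n x = proj G n y) :
    ∃ z, x = ofMu G n z * y := by
  obtain ⟨z, hz⟩ := exists_eq_ofMu_of_proj_eq_one (x := x * y⁻¹)
    (by rw [map_mul, map_inv, h, mul_inv_cancel])
  exact ⟨z, by rw [← hz, inv_mul_cancel_right]⟩

/-- Multiplication by the central subgroup `μ_n` permutes the conjugacy classes of `G̃`. -/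
noncomputable instance : MulAction (rootsOfUnity n ℂ) (ConjClasses (TildeGroup G n)) where
  smul z := Quotient.map (ofMu G n z * ·) fun x y h => by
    obtain ⟨c, rfl⟩ := isConj_iff.1 h
    exact isConj_iff.2 ⟨c, mul_ofMu_mul_mul_inv z c x⟩
  one_smul := Quotient.ind fun x => by
    change ConjClasses.mk (ofMu G n 1 * x) = ConjClasses.mk x
    rw [ofMu_one, one_mul]
  mul_smul z w := Quotient.ind fun x => by
    change ConjClasses.mk (ofMu G n (z * w) * x) = ConjClasses.mk (ofMu G n z * (ofMu G n w * x))
    rw [ofMu_mul, mul_assoc]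

theorem map_proj_smul (z : rootsOfUnity n ℂ) (D : ConjClasses (TildeGroup G n)) :
    ConjClasses.map (proj G n) (z • D) = ConjClasses.map (proj G n) D :=
  Quotient.inductionOn D fun x => congrArg ConjClasses.mk (proj_ofMu_mul z x)

theorem mem_orbit_iff (hπ : Function.Surjective (proj G n)) {D D' : ConjClasses (TildeGroup G n)} :
    D ∈ orbit (rootsOfUnity n ℂ) D' ↔
      ConjClasses.map (proj G n) D = ConjClasses.map (proj G n) D' := by
  refine ⟨fun ⟨z, hz⟩ => hz ▸ map_proj_smul z D', fun h => ?_⟩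
  obtain ⟨x, rfl⟩ := ConjClasses.exists_rep D
  obtain ⟨y, rfl⟩ := ConjClasses.exists_rep D'
  obtain ⟨c, hc⟩ := isConj_iff.1 (ConjClasses.mk_eq_mk_iff_isConj.1 h)
  obtain ⟨c, rfl⟩ := hπ c
  obtain ⟨z, hz⟩ := exists_eq_ofMu_mul (x := c * x * c⁻¹) (y := y) (by simpa using hc)
  exact ⟨z, ConjClasses.mk_eq_mk_iff_isConj.2 (isConj_iff.2 ⟨c, hz⟩).symm⟩

theorem card_fiber_eq_iff (hπ : Function.Surjective (proj G n)) (D : ConjClasses (TildeGroup G n)) :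
    Nat.card {D' // ConjClasses.map (proj G n) D' = ConjClasses.map (proj G n) D} = n ↔
      stabilizer (rootsOfUnity n ℂ) D = ⊥ := by
  rw [← card_orbit_eq_card_iff, Complex.card_rootsOfUnity]
  simp only [← mem_orbit_iff hπ]

variable (G n) in
/-- Functions of linear type, as `μ_n`-equivariant functions on the conjugacy classes of `G̃`. -/
noncomputable def linearTypeFunEquiv : LinearTypeFun G n ≃ₗ[ℂ]
    equivariantFun (X := ConjClasses (TildeGroup G n)) (rootsOfUnity n ℂ).subtype where
  toFun f := ⟨Quotient.lift f.1 fun x y h => by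
      obtain ⟨c, rfl⟩ := isConj_iff.1 h
      exact (f.2.1 c x).symm,
    fun z => Quotient.ind (f.2.2 z)⟩
  invFun f := ⟨fun x => f.1 (ConjClasses.mk x),
    fun h x => congrArg f.1 (ConjClasses.mk_eq_mk_iff_isConj.2 (isConj_iff.2 ⟨h, rfl⟩).symm),
    fun z x => f.2 z (ConjClasses.mk x)⟩
  map_add' f g := Subtype.ext <| funext <| Quotient.ind fun _ => rfl
  map_smul' c f := Subtype.ext <| funext <| Quotient.ind fun _ => rfl
  left_inv f := rfl
  right_inv f := Subtype.ext <| funext <| Quotient.ind fun _ => rfl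

/-- Evaluation of functions of linear type at representatives of the split classes. -/
noncomputable def linearTypeFunEquivSplitClass (hπ : Function.Surjective (proj G n)) :
    LinearTypeFun G n ≃ₗ[ℂ] (SplitClass G n → ℂ) :=
  let s := Function.surjInv (ConjClasses.map_surjective hπ)
  have hs : Function.RightInverse s (ConjClasses.map (proj G n)) := Function.rightInverse_surjInv _
  (linearTypeFunEquiv G n).trans <|
    (equivariantFunEquiv map_proj_smul hs fun D => (mem_orbit_iff hπ).2 (hs _).symm).trans <|
      LinearEquiv.funCongrLeft ℂ ℂ <| Equiv.subtypeEquivRight fun C => by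
        rw [Subgroup.ker_subtype, le_bot_iff, ← card_fiber_eq_iff hπ, hs]

end TildeGroup

/-! ### The center of the crossed product -/

namespace CrossedProduct

open SkewMonoidAlgebra

variable {G : Type u} {A : Type v} [Group G] [Ring A] [MulSemiringAction G A]

theorem mem_center_iff {z : CrossedProduct G A} :
    z ∈ Set.center (CrossedProduct G A) ↔
      (∀ (a : A) g, a * z.coeff g = z.coeff g * g • a) ∧
        ∀ h g, z.coeff (h * g * h⁻¹) = h • z.coeff g := by
  rw [Semigroup.mem_center_iff]
  refine ⟨fun hz => ⟨fun a g => ?_, fun h g => ?_⟩, fun ⟨hA, hG⟩ r => ?_⟩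
  · simpa using congrArg (fun w => w.coeff g) (hz (single 1 a))
  · simpa using (congrArg (fun w => w.coeff (h * g)) (hz (single h 1))).symm
  · induction r using SkewMonoidAlgebra.induction_on' with
    | add r r' h h' => rw [add_mul, mul_add, h, h']
    | single h a =>
      ext g
      rw [coeff_single_mul, coeff_mul_single, ← hG, mul_inv_cancel_left, hA]

end CrossedProduct

namespace TildeGroup

open SkewMonoidAlgebra

variable {G : Type u} {n : ℕ} [Group G] [MulSemiringAction G (MatC n)]

theorem mat_conj (h x : TildeGroup G n) : mat (h * x * h⁻¹) = proj G n h • mat x := by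
  rw [proj_smul, map_mul, map_mul]

theorem trace_proj_smul (x : TildeGroup G n) (a : MatC n) :
    (proj G n x • a).trace = a.trace := by
  rw [proj_smul, Matrix.trace_mul_comm, ← mul_assoc, mat_inv_mul_mat, one_mul]

section LinearType

variable [NeZero n]

theorem mat_ofMu_mul (z : rootsOfUnity n ℂ) (x : TildeGroup G n) :
    mat (ofMu G n z * x) = ((z : ℂˣ) : ℂ) • mat x := by
  have hz : mat (ofMu G n z) = Matrix.scalar (Fin n) ((z : ℂˣ) : ℂ) := rfl
  rw [map_mul, hz, Matrix.scalar_apply, ← Matrix.smul_eq_diagonal_mul]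

theorem smul_mat_inv_ofMu_mul {f : TildeGroup G n → ℂ} (hf : f ∈ LinearTypeFun G n)
    (z : rootsOfUnity n ℂ) (x : TildeGroup G n) :
    f (ofMu G n z * x) • mat (ofMu G n z * x)⁻¹ = f x • mat x⁻¹ := by
  have hz : mat x⁻¹ = ((z : ℂˣ) : ℂ) • mat (ofMu G n z * x)⁻¹ := by
    rw [← mat_ofMu_mul, mul_inv_rev, ← mul_assoc, (commute_ofMu z x⁻¹).eq,
      mul_inv_cancel_right]
  rw [hf.2, hz, smul_smul, mul_comm]

theorem smul_mat_inv_eq_of_proj_eq {f : TildeGroup G n → ℂ} (hf : f ∈ LinearTypeFun G n)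
    {x y : TildeGroup G n} (h : proj G n x = proj G n y) : f x • mat x⁻¹ = f y • mat y⁻¹ := by
  obtain ⟨z, rfl⟩ := exists_eq_ofMu_mul h
  exact smul_mat_inv_ofMu_mul hf z y

theorem exists_coeff_eq_smul_mat_inv [Finite G] (hπ : Function.Surjective (proj G n))
    {f : TildeGroup G n → ℂ} (hf : f ∈ LinearTypeFun G n) :
    ∃ z : CrossedProduct G (MatC n), ∀ x, z.coeff (proj G n x) = f x • mat x⁻¹ := by
  choose l hl using hπ
  exact ⟨⟨Finsupp.equivFunOnFinite.symm fun g => f (l g) • mat (l g)⁻¹⟩,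
    fun x => smul_mat_inv_eq_of_proj_eq hf (hl _)⟩

end LinearType

/-- The linear map sending `∑ a_g g` to `x ↦ n⁻¹ tr (a_{π x} s_x)`, where `s_x` is the matrix of
`x`. If `a_{π x} s_x` is a scalar matrix, this is the scalar. -/
noncomputable def scalarCoeff : CrossedProduct G (MatC n) →ₗ[ℂ] (TildeGroup G n → ℂ) where
  toFun z x := (n : ℂ)⁻¹ * (z.coeff (proj G n x) * mat x).trace
  map_add' z w := by ext; simp [add_mul, mul_add]
  map_smul' c z := by ext; simp [mul_left_comm]

theorem scalarCoeff_eq [NeZero n] {z : CrossedProduct G (MatC n)} {f : TildeGroup G n → ℂ}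
    (h : ∀ x, z.coeff (proj G n x) = f x • mat x⁻¹) : scalarCoeff z = f := by
  funext x
  simp [scalarCoeff, h, mat_inv_mul_mat, mul_left_comm _ (f x)]

section Center

variable [NeZero n] {z : CrossedProduct G (MatC n)}

theorem coeff_eq_scalarCoeff_smul (hz : z ∈ Set.center (CrossedProduct G (MatC n)))
    (x : TildeGroup G n) : z.coeff (proj G n x) = scalarCoeff z x • mat x⁻¹ := by
  have hcomm (a : MatC n) : Commute a (z.coeff (proj G n x) * mat x) := by
    rw [commute_iff_eq, ← mul_assoc, (CrossedProduct.mem_center_iff.1 hz).1, mul_assoc,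
      proj_smul_mul_mat, mul_assoc]
  obtain ⟨c, hc⟩ : z.coeff (proj G n x) * mat x ∈ Set.range (Matrix.scalar (Fin n)) :=
    Matrix.mem_range_scalar_of_commute_single fun i j _ => hcomm _
  have hsc : scalarCoeff z x = c := by
    simp [scalarCoeff, ← hc, inv_mul_cancel_left₀ (NeZero.ne (n : ℂ))]
  calc z.coeff (proj G n x) = z.coeff (proj G n x) * mat x * mat x⁻¹ := by
        rw [mul_assoc, mat_mul_mat_inv, mul_one]
    _ = scalarCoeff z x • mat x⁻¹ := by
        rw [← hc, hsc, Matrix.scalar_apply, ← Matrix.smul_eq_diagonal_mul]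

theorem scalarCoeff_mem_linearTypeFun (hz : z ∈ Set.center (CrossedProduct G (MatC n))) :
    scalarCoeff z ∈ LinearTypeFun G n := by
  refine ⟨fun h x => ?_, fun w x => ?_⟩
  · change (n : ℂ)⁻¹ * _ = (n : ℂ)⁻¹ * _
    rw [mat_conj, map_mul (proj G n), map_mul (proj G n), map_inv (proj G n),
      (CrossedProduct.mem_center_iff.1 hz).2, ← smul_mul', trace_proj_smul]
  · simp [scalarCoeff, proj_ofMu_mul, mat_ofMu_mul, mul_left_comm]

theorem mem_center_of_coeff_eq [SMulCommClass G ℂ (MatC n)] (hπ : Function.Surjective (proj G n))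
    {f : TildeGroup G n → ℂ} (hf : f ∈ LinearTypeFun G n)
    (h : ∀ x, z.coeff (proj G n x) = f x • mat x⁻¹) :
    z ∈ Set.center (CrossedProduct G (MatC n)) := by
  refine CrossedProduct.mem_center_iff.2 ⟨fun a => hπ.forall.2 fun x => ?_,
    hπ.forall₂.2 fun y x => ?_⟩
  · rw [h, mul_smul_comm, smul_mul_assoc, proj_smul, ← mul_assoc, ← mul_assoc, mat_inv_mul_mat,
      one_mul]
  · rw [← map_inv, ← map_mul, ← map_mul, h, h, hf.1, conj_inv, mat_conj, smul_comm (proj G n y)]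

/-- The isomorphism between the center of `G ⋉ M_n(ℂ)` and the functions of linear type. -/
noncomputable def centerEquivLinearTypeFun [Finite G] [SMulCommClass G ℂ (MatC n)]
    (hπ : Function.Surjective (proj G n)) :
    Subalgebra.center ℂ (CrossedProduct G (MatC n)) ≃ₗ[ℂ] LinearTypeFun G n :=
  .ofBijective
    ((scalarCoeff ∘ₗ (Subalgebra.center ℂ (CrossedProduct G (MatC n))).val.toLinearMap).codRestrict
      (LinearTypeFun G n) fun z => scalarCoeff_mem_linearTypeFun z.2) <| by
    refine ⟨fun z w hzw => Subtype.ext (SkewMonoidAlgebra.ext (hπ.forall.2 fun x => ?_)), ?_⟩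
    · have h : scalarCoeff z.1 = scalarCoeff w.1 := congrArg Subtype.val hzw
      rw [coeff_eq_scalarCoeff_smul z.2, coeff_eq_scalarCoeff_smul w.2, h]
    · rintro ⟨f, hf⟩
      obtain ⟨z, hz⟩ := exists_coeff_eq_smul_mat_inv hπ hf
      exact ⟨⟨z, mem_center_of_coeff_eq hπ hf hz⟩, Subtype.ext (scalarCoeff_eq hz)⟩
end Center

end TildeGroup

theorem theorem6p5 {G : Type u} [Group G] [Finite G] (n : ℕ) [NeZero n]
    -- `G` acts on the `*`-algebra `A = M_n(ℂ)` by (`ℂ`-linear) `*`-automorphisms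
    [MulSemiringAction G (MatC n)] [SMulCommClass G ℂ (MatC n)]
    (hstar : ∀ (g : G) (a : MatC n), g • star a = star (g • a)) :
    -- the identification `K_G(A) = K(G ⋉ A)`
    (∃ Φ : EquivKGroup G (MatC n) ≃+ KGroup (CrossedProduct G (MatC n)),
      ∀ (E : EquivProjMod G (MatC n)) (M : ProjMod (CrossedProduct G (MatC n))),
        SameModule E M → Φ E.toK = M.toK) ∧
    -- `K(G ⋉ A)` is free abelian, of rank the number of classes that split into `n` classes
    Module.Free ℤ (KGroup (CrossedProduct G (MatC n))) ∧
    Module.Finite ℤ (KGroup (CrossedProduct G (MatC n))) ∧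
    Module.finrank ℤ (KGroup (CrossedProduct G (MatC n))) =
      Nat.card (TildeGroup.SplitClass G n) ∧
    -- functions of linear type on `G̃` correspond to functions on the set of these classes
    Nonempty (TildeGroup.LinearTypeFun G n ≃ₗ[ℂ] (TildeGroup.SplitClass G n → ℂ)) := by
  have hG : IsUnit (Nat.card G : MatC n) := by
    have h : (Nat.card G : ℂ) ≠ 0 := Nat.cast_ne_zero.2 Nat.card_pos.ne'
    simpa using h.isUnit.map (algebraMap ℂ (MatC n))
  have hπ := TildeGroup.proj_surjective n hstar
  have : IsSemisimpleRing (CrossedProduct G (MatC n)) := CrossedProduct.isSemisimpleRing G hG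
  have : Module.Finite ℂ (CrossedProduct G (MatC n)) :=
    .equiv (SkewMonoidAlgebra.coeffLinearEquiv (k := MatC n) (G := G) (S := ℂ)).symm
  have : Finite (TildeGroup.SplitClass G n) := Subtype.finite
  have := Fintype.ofFinite (TildeGroup.SplitClass G n)
  refine ⟨EquivKGroup.exists_addEquiv hG, KGroup.free ℂ _, KGroup.finite ℂ _, ?_,
    ⟨TildeGroup.linearTypeFunEquivSplitClass hπ⟩⟩
  rw [KGroup.finrank_eq ℂ, (TildeGroup.centerEquivLinearTypeFun hπ).finrank_eq,
    (TildeGroup.linearTypeFunEquivSplitClass hπ).finrank_eq, Module.finrank_fintype_fun_eq_card,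
    Nat.card_eq_fintype_card]
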